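/- Let $q\equiv 1 \pmod 4$ be a prime power, $n\ge 1$, $V$ a $2n$-dimensional vector space over $\mathbb F_q$, and $B$ a nondegenerate alternating bilinear form on $V$. Let $\mathcal V$ be the set of subspaces $X\le V$ with $X^\perp=X$ (all of dimension $n$), and let $\Gamma$ be the graph on $\mathcal V$ in which $X,Y$ are adjacent iff $X\cap Y$ has codimension $1$ in both $X$ and $Y$; let $d$ be the distance in $\Gamma$. For each $X\in\mathcal V$ fix a nonzero alternating $n$-linear form $\delta_X:X^n\to\mathbb F_q$. Let $\chi:\mathbb F_q^\times\to\{\pm1\}$ be the quadratic character. For $X\ne Y$ in $\mathcal V$ with $X\cap Y$ of codimension $j$ in $X$ and $Y$, choose bases $x_1,\dots,x_n$ of $X$ and $y_1,\dots,y_n$ of $Y$ such that $x_i=y_i$ for $j<i\le n$ and these common vectors form a basis of $X\cap Y$, and put $$\sigma(X,Y)=\chi\bigl(\delta_X(x_1,\dots,x_n)\,\delta_Y(y_1,\dots,y_n)\,\det[B(x_r,y_s)]_{1\le r,s\le j}\bigr),$$ which does not depend on the choice of these bases. A triple $(X,Y,Z)$ of distinct elements of $\mathcal V$ is called coherent if $\sigma(X,Y)\,\sigma(Y,Z)\,\sigma(Z,X)=1$.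 Let $X,Y\in\mathcal V$ with $d(X,Y)=k$. Then $Y$ has exactly $q^k-1$ neighbours $Z$ in $\Gamma$ with $d(X,Z)=k$, and for exactly half of these $Z$, that is, for $(q^k-1)/2$ of them, the triple $(X,Y,Z)$ is coherent. -/

import Mathlib

section MaslovTwoGraph

open Module

variable {F : Type*} [Field F] {V : Type*} [AddCommGroup V] [Module F V]

/-- The generators of `(V, B)`: the subspaces `X` with `X^⊥ = X`. -/
abbrev Generator (B : LinearMap.BilinForm F V) : Type _ :=
  {X : Submodule F V // B.orthogonal X = X}

/-- The dual polar graph: `X` and `Y` are adjacent iff `X ∩ Y` has codimension 1 in both. -/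
def dualPolarGraph (B : LinearMap.BilinForm F V) : SimpleGraph (Generator B) where
  Adj X Y :=
    finrank F ↥(X.1 ⊓ Y.1) + 1 = finrank F X.1 ∧ finrank F ↥(X.1 ⊓ Y.1) + 1 = finrank F Y.1
  symm := ⟨fun X Y h => by rw [inf_comm]; exact ⟨h.2, h.1⟩⟩
  loopless := ⟨fun X h => by have h1 := h.1; rw [inf_idem] at h1; omega⟩

/-- The codimension of `X ∩ Y` in `X` (also its codimension in `Y` when `X`, `Y` are generators,
which all have dimension `n`). -/
noncomputable def interCodim (X Y : Submodule F V) : ℕ :=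
  finrank F X - finrank F ↥(X ⊓ Y)

/-- A pair of bases `x₁, …, xₙ` of `X` and `y₁, …, yₙ` of `Y` (indexed from `0` here) such that
`xᵢ = yᵢ` for all indices beyond the first `k`, and these vectors form a basis of `X ∩ Y`, where
`k` is the codimension of `X ∩ Y`. -/
structure AdaptedBases (n : ℕ) (X Y : Submodule F V) where
  x : Basis (Fin n) F X
  y : Basis (Fin n) F Y
  common : ∀ i : Fin n, interCodim X Y ≤ (i : ℕ) → (x i : V) = (y i : V)
  span_common :
    Submodule.span F {v : V | ∃ i : Fin n, interCodim X Y ≤ (i : ℕ) ∧ (x i : V) = v} = X ⊓ Y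

/-- The scalar `δ_X(x₁, …, xₙ) δ_Y(y₁, …, yₙ) det [B(xᵢ, yⱼ) : 1 ≤ i, j ≤ k]`. -/
noncomputable def maslovScalar {n : ℕ} (B : LinearMap.BilinForm F V) {X Y : Submodule F V}
    (δX : X [⋀^Fin n]→ₗ[F] F) (δY : Y [⋀^Fin n]→ₗ[F] F) (b : AdaptedBases n X Y) : F :=
  δX b.x * δY b.y *
    (Matrix.of fun i j : {i : Fin n // (i : ℕ) < interCodim X Y} =>
      B (b.x i.1 : V) (b.y j.1 : V)).det

open Classical in
/-- The Maslov index `σ(X, Y)`: the quadratic character of the scalar above, for some choice of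
adapted bases of `X` and `Y`. -/
noncomputable def maslovIndex [Fintype F] {n : ℕ} (B : LinearMap.BilinForm F V)
    (δ : ∀ X : Generator B, X.1 [⋀^Fin n]→ₗ[F] F) (X Y : Generator B) : ℤ :=
  if h : Nonempty (AdaptedBases n X.1 Y.1) then
    quadraticChar F (maslovScalar B (δ X) (δ Y) h.some)
  else 0

/-- A triple of distinct generators is coherent if `σ(X, Y) σ(Y, Z) σ(Z, X) = 1`. -/
def IsCoherent [Fintype F] {n : ℕ} (B : LinearMap.BilinForm F V)
    (δ : ∀ X : Generator B, X.1 [⋀^Fin n]→ₗ[F] F) (X Y Z : Generator B) : Prop :=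
  X ≠ Y ∧ Y ≠ Z ∧ Z ≠ X ∧
    maslovIndex B δ X Y * maslovIndex B δ Y Z * maslovIndex B δ Z X = 1

end MaslovTwoGraph

/-! The distance d(X, Y) is the codimension k of X ∩ Y in X (`dualPolarGraph_dist_eq`). For w ∈ X \
Y and a ≠ 0 the symplectic transvection v ↦ v + a B(v, w) w fixes X pointwise and moves Y to a
neighbour of Y at the same distance from X; every such neighbour arises in this way
(`exists_transvect_eq`).

Rescaling w changes a by a square, so a = 1 and a = ν, with ν a fixed nonsquare, already give all
these neighbours. For fixed a, two vectors give the same neighbour iff they agree up to sign modulo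
Y (`transvect_eq_iff`), so each of the two classes has (q^k - 1)/2 members
(`two_mul_ncard_transvectSet`).

Carrying adapted bases along by the transvection shows that the product of the three Maslov indices
is χ(a) (`maslovIndex_mul_transvect`); here -1 has to be a square. Hence the class a = 1 is
coherent, the class a = ν is not, and in particular the two are disjoint. -/

section GeneratorGeometry

open Module

variable {F : Type*} [Field F] {V : Type*} [AddCommGroup V] [Module F V]

/-! ### Generators and distance in the dual polar graph. -/

section

variable {B : LinearMap.BilinForm F V}

theorem Generator.mem_iff (X : Generator B) {v : V} : v ∈ X.1 ↔ ∀ x ∈ X.1, B x v = 0 := by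
  conv_lhs => rw [← X.2]
  exact LinearMap.BilinForm.mem_orthogonal_iff

theorem Generator.apply_eq_zero (X : Generator B) {u v : V} (hu : u ∈ X.1) (hv : v ∈ X.1) :
    B u v = 0 :=
  X.mem_iff.1 hv u hu

variable [FiniteDimensional F V] {n : ℕ}

theorem Generator.finrank_eq (hn : finrank F V = 2 * n) (hBnd : B.Nondegenerate)
    (X : Generator B) : finrank F X.1 = n := by
  have h := LinearMap.BilinForm.finrank_orthogonal hBnd X.1
  rw [X.2] at h
  have := X.1.finrank_le
  omega

/-- A totally isotropic subspace of half the dimension is a generator. -/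
theorem orthogonal_eq_of_isotropic (hn : finrank F V = 2 * n) (hBnd : B.Nondegenerate)
    {X : Submodule F V} (hX : ∀ u ∈ X, ∀ v ∈ X, B u v = 0) (hd : finrank F X = n) :
    B.orthogonal X = X := by
  symm
  apply Submodule.eq_of_le_of_finrank_le
  · intro v hv
    rw [LinearMap.BilinForm.mem_orthogonal_iff]
    exact fun u hu => hX u hu v hv
  · rw [LinearMap.BilinForm.finrank_orthogonal hBnd]
    omega

theorem interCodim_add_finrank_inf (X Y : Submodule F V) :
    interCodim X Y + finrank F ↥(X ⊓ Y) = finrank F X :=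
  Nat.sub_add_cancel (Submodule.finrank_mono inf_le_left)

theorem interCodim_comm (hn : finrank F V = 2 * n) (hBnd : B.Nondegenerate) (X Y : Generator B) :
    interCodim X.1 Y.1 = interCodim Y.1 X.1 := by
  rw [interCodim, interCodim, X.finrank_eq hn hBnd, Y.finrank_eq hn hBnd, inf_comm]

theorem interCodim_eq_zero_iff (hn : finrank F V = 2 * n) (hBnd : B.Nondegenerate)
    {X Y : Generator B} : interCodim X.1 Y.1 = 0 ↔ X = Y := by
  constructor
  · intro h
    have h1 := interCodim_add_finrank_inf X.1 Y.1
    have h2 : X.1 ⊓ Y.1 = X.1 :=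
      Submodule.eq_of_le_of_finrank_le inf_le_left (by omega)
    exact Subtype.ext (Submodule.eq_of_le_of_finrank_le (inf_eq_left.1 h2)
      (by rw [X.finrank_eq hn hBnd, Y.finrank_eq hn hBnd]))
  · rintro rfl
    rw [interCodim, inf_idem, Nat.sub_self]

theorem dualPolarGraph_adj_iff (hn : finrank F V = 2 * n) (hBnd : B.Nondegenerate)
    {X Y : Generator B} : (dualPolarGraph B).Adj X Y ↔ interCodim X.1 Y.1 = 1 := by
  have h := interCodim_add_finrank_inf X.1 Y.1
  have h2 := X.finrank_eq hn hBnd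
  have h3 := Y.finrank_eq hn hBnd
  change _ ∧ _ ↔ _
  omega

/-- Both X ∩ Y and Y ∩ Z lie in Y, so the dimension formula bounds their intersection from below,
and that lies in X ∩ Z. -/
theorem interCodim_triangle (hn : finrank F V = 2 * n) (hBnd : B.Nondegenerate)
    (X Y Z : Generator B) :
    interCodim X.1 Z.1 ≤ interCodim X.1 Y.1 + interCodim Y.1 Z.1 := by
  have h1 := interCodim_add_finrank_inf X.1 Y.1
  have h2 := interCodim_add_finrank_inf Y.1 Z.1
  have h3 := interCodim_add_finrank_inf X.1 Z.1
  have h4 := X.finrank_eq hn hBnd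
  have h5 := Y.finrank_eq hn hBnd
  have h6 := Submodule.finrank_sup_add_finrank_inf_eq (X.1 ⊓ Y.1) (Y.1 ⊓ Z.1)
  have h7 : finrank F ↥(X.1 ⊓ Y.1 ⊔ Y.1 ⊓ Z.1) ≤ finrank F Y.1 :=
    Submodule.finrank_mono (sup_le inf_le_right inf_le_left)
  have h8 : finrank F ↥(X.1 ⊓ Y.1 ⊓ (Y.1 ⊓ Z.1)) ≤ finrank F ↥(X.1 ⊓ Z.1) :=
    Submodule.finrank_mono (fun v hv => ⟨hv.1.1, hv.2.2⟩)
  omega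

/-- The hyperplane `Y ∩ w^⊥` of `Y`, for `w ∉ Y`. -/
theorem finrank_inf_ker_flip (Y : Generator B) {w : V} (hw : w ∉ Y.1) :
    finrank F ↥(Y.1 ⊓ LinearMap.ker (B.flip w)) + 1 = finrank F Y.1 := by
  have hne : (B.flip w).comp Y.1.subtype ≠ 0 := by
    intro h
    refine hw (Y.mem_iff.2 fun y hy => ?_)
    exact LinearMap.congr_fun h ⟨y, hy⟩
  have h1 := Module.Dual.finrank_ker_add_one_of_ne_zero hne
  rw [← h1, LinearMap.ker_comp]
  rw [← Submodule.map_comap_subtype, Submodule.finrank_map_subtype_eq]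

/-- The neighbour `(Y ∩ w^⊥) + ⟨w⟩` of `Y`, for `w ∉ Y`. -/
theorem exists_adj_mem (hn : finrank F V = 2 * n) (hBnd : B.Nondegenerate) (hB : B.IsAlt)
    (Y : Generator B) {w : V} (hw : w ∉ Y.1) :
    ∃ Z : Generator B, (dualPolarGraph B).Adj Y Z ∧ w ∈ Z.1 ∧
      Y.1 ⊓ LinearMap.ker (B.flip w) ≤ Z.1 := by
  set H := Y.1 ⊓ LinearMap.ker (B.flip w) with hH
  have hwH : w ∉ H := fun h => hw h.1
  have hd := finrank_inf_ker_flip Y hw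
  have hdZ : finrank F ↥(H ⊔ Submodule.span F {w}) = finrank F H + 1 :=
    Submodule.finrank_sup_span_singleton hwH
  have hY := Y.finrank_eq hn hBnd
  have hHw : ∀ u ∈ H, B u w = 0 := fun u hu => hu.2
  have hiso : ∀ u ∈ H ⊔ Submodule.span F {w}, ∀ v ∈ H ⊔ Submodule.span F {w}, B u v = 0 := by
    intro u hu v hv
    obtain ⟨u, hu₁, _, hu', rfl⟩ := Submodule.mem_sup.1 hu
    obtain ⟨v, hv₁, _, hv', rfl⟩ := Submodule.mem_sup.1 hv
    obtain ⟨a, rfl⟩ := Submodule.mem_span_singleton.1 hu'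
    obtain ⟨b, rfl⟩ := Submodule.mem_span_singleton.1 hv'
    simp [Y.apply_eq_zero hu₁.1 hv₁.1, hHw u hu₁, hB.isRefl v w (hHw v hv₁),
      hB.self_eq_zero w]
  have hwZ : w ∈ H ⊔ Submodule.span F {w} :=
    Submodule.mem_sup_right (Submodule.mem_span_singleton_self w)
  let Z : Generator B := ⟨H ⊔ Submodule.span F {w},
    orthogonal_eq_of_isotropic hn hBnd hiso (by rw [← hH] at hd; omega)⟩
  refine ⟨Z, ?_, hwZ, le_sup_left⟩
  have h1 : finrank F H ≤ finrank F ↥(Y.1 ⊓ Z.1) :=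
    Submodule.finrank_mono (le_inf inf_le_left le_sup_left)
  have h2 : finrank F ↥(Y.1 ⊓ Z.1) < finrank F Z.1 :=
    Submodule.finrank_lt_finrank_of_lt (lt_of_le_of_ne inf_le_right
      (fun h => hw ((inf_eq_right.1 h) hwZ)))
  have h3 := Z.finrank_eq hn hBnd
  rw [← hH] at hd
  change _ ∧ _
  omega

/-- For w ∈ X \ Y, the neighbour (Y ∩ w^⊥) + ⟨w⟩ keeps X ∩ Y, because X is isotropic, and gains w.
-/
theorem exists_adj_interCodim_eq (hn : finrank F V = 2 * n) (hBnd : B.Nondegenerate)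
    (hB : B.IsAlt) {X Y : Generator B} {m : ℕ} (h : interCodim X.1 Y.1 = m + 1) :
    ∃ Z : Generator B, (dualPolarGraph B).Adj Y Z ∧ interCodim X.1 Z.1 ≤ m := by
  have hnot : ¬ X.1 ≤ Y.1 := by
    intro hle
    rw [interCodim, inf_eq_left.2 hle, Nat.sub_self] at h
    omega
  obtain ⟨w, hwX, hwY⟩ := SetLike.not_le_iff_exists.1 hnot
  obtain ⟨Z, hZ, hwZ, hle⟩ := exists_adj_mem hn hBnd hB Y hwY
  refine ⟨Z, hZ, ?_⟩
  have h1 : finrank F ↥(X.1 ⊓ Y.1) < finrank F ↥(X.1 ⊓ Z.1) := by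
    refine Submodule.finrank_lt_finrank_of_lt (lt_of_le_of_ne ?_ ?_)
    · exact fun v hv => ⟨hv.1, hle ⟨hv.2, X.apply_eq_zero hv.1 hwX⟩⟩
    · intro he
      exact hwY (he.symm ▸ (⟨hwX, hwZ⟩ : w ∈ X.1 ⊓ Z.1) : w ∈ X.1 ⊓ Y.1).2
  have h2 := interCodim_add_finrank_inf X.1 Y.1
  have h3 := interCodim_add_finrank_inf X.1 Z.1
  omega

theorem interCodim_le_length (hn : finrank F V = 2 * n) (hBnd : B.Nondegenerate)
    {X Y : Generator B} (p : (dualPolarGraph B).Walk X Y) : interCodim X.1 Y.1 ≤ p.length := by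
  induction p with
  | nil => rw [(interCodim_eq_zero_iff hn hBnd).2 rfl]; exact Nat.zero_le _
  | @cons X Y Z h p ih =>
    have h1 := interCodim_triangle hn hBnd X Y Z
    rw [(dualPolarGraph_adj_iff hn hBnd).1 h] at h1
    rw [SimpleGraph.Walk.length_cons]
    omega

theorem exists_walk_length_le (hn : finrank F V = 2 * n) (hBnd : B.Nondegenerate)
    (hB : B.IsAlt) (m : ℕ) (X Y : Generator B) (h : interCodim X.1 Y.1 ≤ m) :
    ∃ p : (dualPolarGraph B).Walk X Y, p.length ≤ m := by
  induction m generalizing Y with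
  | zero =>
    obtain rfl := (interCodim_eq_zero_iff hn hBnd).1 (Nat.le_zero.1 h)
    exact ⟨.nil, le_rfl⟩
  | succ m ih =>
    rcases Nat.of_le_succ h with h | h
    · obtain ⟨p, hp⟩ := ih Y h
      exact ⟨p, hp.trans m.le_succ⟩
    · obtain ⟨Z, hZ, hm⟩ := exists_adj_interCodim_eq hn hBnd hB h
      obtain ⟨p, hp⟩ := ih Z hm
      exact ⟨p.concat hZ.symm, by rw [SimpleGraph.Walk.length_concat]; omega⟩

/-- The distance in the dual polar graph is the codimension of the intersection. -/
theorem dualPolarGraph_dist_eq (hn : finrank F V = 2 * n) (hBnd : B.Nondegenerate)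
    (hB : B.IsAlt) (X Y : Generator B) :
    (dualPolarGraph B).dist X Y = interCodim X.1 Y.1 := by
  obtain ⟨p, hp⟩ := exists_walk_length_le hn hBnd hB _ X Y le_rfl
  -- `dist` takes the value 0 between unreachable vertices; the walk `p` excludes that case.
  obtain ⟨p', hp'⟩ := p.reachable.exists_walk_length_eq_dist
  exact le_antisymm ((SimpleGraph.dist_le p).trans hp)
    (hp' ▸ interCodim_le_length hn hBnd p')

end

/-! ### Transvections and the neighbours of Y at the same distance from X. -/

section Transvection

variable {B : LinearMap.BilinForm F V}

/-- The symplectic transvection `v ↦ v + a B(v, w) w`. -/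
def sympTransvection (hB : B.IsAlt) (w : V) (a : F) : V ≃ₗ[F] V :=
  LinearEquiv.transvection (f := a • B.flip w) (v := w) (by
    simp [hB.self_eq_zero w])

theorem sympTransvection_apply (hB : B.IsAlt) (w : V) (a : F) (v : V) :
    sympTransvection hB w a v = v + (a * B v w) • w := by
  simp [sympTransvection, LinearMap.transvection.apply]

theorem sympTransvection_apply_of_eq_zero (hB : B.IsAlt) {w v : V} (a : F) (h : B v w = 0) :
    sympTransvection hB w a v = v := by
  rw [sympTransvection_apply, h, mul_zero, zero_smul, add_zero]

theorem apply_sympTransvection (hB : B.IsAlt) (w : V) (a : F) (u v : V) :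
    B (sympTransvection hB w a u) (sympTransvection hB w a v) = B u v := by
  have h : B w v = - B v w := (hB.neg_eq v w).symm
  simp only [sympTransvection_apply, map_add, map_smul, LinearMap.add_apply, LinearMap.smul_apply,
    smul_eq_mul, hB.self_eq_zero w, h]
  ring

/-- The image of a generator under a symplectic transvection. -/
def Generator.transvect (hB : B.IsAlt) (Y : Generator B) (w : V) (a : F) : Generator B :=
  ⟨Y.1.map (sympTransvection hB w a).toLinearMap, by
    ext v
    obtain ⟨v, rfl⟩ := (sympTransvection hB w a).surjective v
    rw [LinearMap.BilinForm.mem_orthogonal_iff]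
    constructor
    · intro h
      refine ⟨v, Y.mem_iff.2 fun y hy => ?_, rfl⟩
      rw [← apply_sympTransvection hB w a]
      exact h _ ⟨y, hy, rfl⟩
    · rintro ⟨v', hv', hv⟩
      obtain rfl := (sympTransvection hB w a).injective hv
      rintro _ ⟨y, hy, rfl⟩
      exact (apply_sympTransvection hB w a _ _).trans (Y.apply_eq_zero hy hv')⟩

variable (hB : B.IsAlt) {X Y : Generator B} {w : V} {a : F}
include hB

theorem Generator.mem_transvect {z : V} :
    z ∈ (Y.transvect hB w a).1 ↔ ∃ y ∈ Y.1, y + (a * B y w) • w = z := by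
  simp only [← sympTransvection_apply hB]
  exact Iff.rfl

theorem inf_transvect (hw : w ∉ Y.1) (ha : a ≠ 0) :
    Y.1 ⊓ (Y.transvect hB w a).1 = Y.1 ⊓ LinearMap.ker (B.flip w) := by
  ext v
  constructor
  · rintro ⟨hv, hv'⟩
    obtain ⟨y, hy, rfl⟩ := (Generator.mem_transvect hB).1 hv'
    have h1 : (a * B y w) • w ∈ Y.1 := (Submodule.add_mem_iff_right _ hy).1 hv
    have h2 : B y w = 0 := by
      by_contra h
      exact hw ((Submodule.smul_mem_iff _ (mul_ne_zero ha h)).1 h1)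
    refine ⟨hv, ?_⟩
    change B _ w = 0
    simp [h2]
  · rintro ⟨hv, hv'⟩
    change B v w = 0 at hv'
    exact ⟨hv, (Generator.mem_transvect hB).2 ⟨v, hv, by simp [hv']⟩⟩

/-- X is isotropic, so a transvection along one of its vectors fixes X pointwise. -/
theorem inf_transvect_eq_of_mem (hw : w ∈ X.1) :
    X.1 ⊓ (Y.transvect hB w a).1 = X.1 ⊓ Y.1 := by
  ext v
  constructor
  · rintro ⟨hv, hv'⟩
    obtain ⟨y, hy, rfl⟩ := (Generator.mem_transvect hB).1 hv'
    have hyX : y ∈ X.1 := (Submodule.add_mem_iff_left _ (X.1.smul_mem _ hw)).1 hv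
    rw [X.apply_eq_zero hyX hw, mul_zero, zero_smul, add_zero]
    exact ⟨hyX, hy⟩
  · rintro ⟨hv, hv'⟩
    refine ⟨hv, (Generator.mem_transvect hB).2 ⟨v, hv', ?_⟩⟩
    rw [X.apply_eq_zero hv hw, mul_zero, zero_smul, add_zero]

variable [FiniteDimensional F V] {n : ℕ}

theorem adj_transvect (hn : finrank F V = 2 * n) (hBnd : B.Nondegenerate) (hw : w ∉ Y.1)
    (ha : a ≠ 0) : (dualPolarGraph B).Adj Y (Y.transvect hB w a) := by
  have h := finrank_inf_ker_flip Y hw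
  rw [← inf_transvect hB hw ha] at h
  exact ⟨h, by rw [h, Y.finrank_eq hn hBnd, Generator.finrank_eq hn hBnd]⟩

omit [FiniteDimensional F V] in
theorem interCodim_transvect (hw : w ∈ X.1) :
    interCodim X.1 (Y.transvect hB w a).1 = interCodim X.1 Y.1 := by
  rw [interCodim, interCodim, inf_transvect_eq_of_mem hB hw]

omit hB in
/-- A neighbour of `Y` at the same distance from `X` contains `X ∩ Y`. -/
theorem inf_eq_inf_of_adj {Z : Generator B}
    (hYZ : (dualPolarGraph B).Adj Y Z) (h : interCodim X.1 Z.1 = interCodim X.1 Y.1) :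
    X.1 ⊓ Z.1 = X.1 ⊓ Y.1 := by
  have hX1 := interCodim_add_finrank_inf X.1 Y.1
  have hX2 := interCodim_add_finrank_inf X.1 Z.1
  by_contra hne
  -- Some u ∈ X ∩ Y would lie outside Z, so Y = (Y ∩ Z) + ⟨u⟩. A vector of X ∩ Z is orthogonal to
  -- both summands, hence lies in Y^⊥ = Y.
  have hnot : ¬ X.1 ⊓ Y.1 ≤ Z.1 := fun hle => hne
    (Submodule.eq_of_le_of_finrank_le (le_inf inf_le_left hle) (by omega)).symm
  obtain ⟨u, huXY, huZ⟩ := SetLike.not_le_iff_exists.1 hnot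
  have huY : u ∈ Y.1 := huXY.2
  set H := Y.1 ⊓ Z.1 with hH
  have hY : H ⊔ Submodule.span F {u} = Y.1 := by
    apply Submodule.eq_of_le_of_finrank_le
    · exact sup_le inf_le_left ((Submodule.span_singleton_le_iff_mem _ _).2 huY)
    · rw [Submodule.finrank_sup_span_singleton (fun h : u ∈ H => huZ h.2)]
      exact hYZ.1.ge
  have hle : X.1 ⊓ Z.1 ≤ X.1 ⊓ Y.1 := by
    rintro v ⟨hvX, hvZ⟩
    refine ⟨hvX, Y.mem_iff.2 fun y hy => ?_⟩
    rw [← hY] at hy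
    obtain ⟨y, hy₁, _, hu', rfl⟩ := Submodule.mem_sup.1 hy
    obtain ⟨c, rfl⟩ := Submodule.mem_span_singleton.1 hu'
    simp [Z.apply_eq_zero hy₁.2 hvZ, X.apply_eq_zero huXY.1 hvX]
  exact hne (Submodule.eq_of_le_of_finrank_le hle (by omega))

/-- The neighbours of `Y` at the same distance from `X` are the images of `Y` under transvections
along vectors of `X`. -/
theorem exists_transvect_eq (hn : finrank F V = 2 * n) (hBnd : B.Nondegenerate) {Z : Generator B}
    (hYZ : (dualPolarGraph B).Adj Y Z) (h : interCodim X.1 Z.1 = interCodim X.1 Y.1) :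
    ∃ w ∈ X.1, w ∉ Y.1 ∧ ∃ a : F, a ≠ 0 ∧ Z = Y.transvect hB w a := by
  have hXZ := inf_eq_inf_of_adj hYZ h
  have hdY := hYZ.1
  have hdZ := hYZ.2
  set H := Y.1 ⊓ Z.1 with hH
  have hXYH : X.1 ⊓ Y.1 ≤ H := le_inf inf_le_right (hXZ ▸ inf_le_right)
  -- The vector w must lie in X and be orthogonal to H. If X ∩ H^⊥ ≤ Y, then taking orthogonals
  -- gives Y ≤ X + H, so Y ≤ (X ∩ Y) + H = H, against the dimensions.
  have hnot : ¬ X.1 ⊓ B.orthogonal H ≤ Y.1 := by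
    intro hle
    have h1 : Y.1 ≤ X.1 ⊔ H := by
      rw [← LinearMap.BilinForm.orthogonal_orthogonal hBnd hB.isRefl (X.1 ⊔ H)]
      intro y hy
      rw [LinearMap.BilinForm.mem_orthogonal_iff]
      intro v hv
      rw [LinearMap.BilinForm.mem_orthogonal_iff] at hv
      refine Y.apply_eq_zero (hle ⟨X.mem_iff.2 fun x hx => hv x (Submodule.mem_sup_left hx), ?_⟩) hy
      exact LinearMap.BilinForm.mem_orthogonal_iff.2
        fun x hx => hv x (Submodule.mem_sup_right hx)
    have h2 : Y.1 ≤ H := by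
      intro y hy
      obtain ⟨x, hx, v, hv, rfl⟩ := Submodule.mem_sup.1 (h1 hy)
      exact H.add_mem (hXYH ⟨hx, (Submodule.add_mem_iff_left _ hv.1).1 hy⟩) hv
    have := Submodule.finrank_mono h2
    omega
  obtain ⟨w, ⟨hwX, hwH⟩, hwY⟩ := SetLike.not_le_iff_exists.1 hnot
  replace hwH := LinearMap.BilinForm.mem_orthogonal_iff.1 hwH
  have hHw : Y.1 ⊓ LinearMap.ker (B.flip w) = H := by
    have h1 := finrank_inf_ker_flip Y hwY
    exact (Submodule.eq_of_le_of_finrank_le (le_inf inf_le_left fun v hv => hwH v hv)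
      (Nat.le_of_add_le_add_right (h1.trans hdY.symm).le)).symm
  obtain ⟨z, hzZ, hzH⟩ : ∃ z ∈ Z.1, z ∉ H :=
    SetLike.not_le_iff_exists.1 fun hle => by
      have := Submodule.finrank_mono hle
      omega
  have hzY : z ∉ Y.1 := fun hz => hzH ⟨hz, hzZ⟩
  obtain ⟨y₀, hy₀, hB₀⟩ : ∃ y ∈ Y.1, B y w ≠ 0 := by
    by_contra! hcon
    exact hwY (Y.mem_iff.2 hcon)
  have hYsup : H ⊔ Submodule.span F {y₀} = Y.1 := by
    apply Submodule.eq_of_le_of_finrank_le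
    · exact sup_le inf_le_left ((Submodule.span_singleton_le_iff_mem _ _).2 hy₀)
    · rw [Submodule.finrank_sup_span_singleton fun hy => hB₀ (hwH _ hy)]
      exact hdY.ge
  -- This c makes z - c w orthogonal to y₀. It is orthogonal to H as well, so it lies in Y^⊥ = Y,
  -- and z becomes its image under the transvection with parameter c / B(z - c w, w).
  set c := B y₀ z / B y₀ w with hc
  have hy₁ : z - c • w ∈ Y.1 := by
    refine Y.mem_iff.2 fun y hy => ?_
    rw [← hYsup] at hy
    obtain ⟨y, hy₁, _, hu', rfl⟩ := Submodule.mem_sup.1 hy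
    obtain ⟨e, rfl⟩ := Submodule.mem_span_singleton.1 hu'
    have h1 : B y z = 0 := Z.apply_eq_zero hy₁.2 hzZ
    have h2 : B y w = 0 := hwH y hy₁
    have h3 : B y₀ z - c * B y₀ w = 0 := by rw [hc, div_mul_cancel₀ _ hB₀, sub_self]
    simp [h1, h2, h3]
  have hc0 : c ≠ 0 := by
    intro h0
    rw [h0, zero_smul, sub_zero] at hy₁
    exact hzY hy₁
  have hb : B (z - c • w) w ≠ 0 := by
    intro h0
    have h1 : z - c • w ∈ H := hHw ▸ ⟨hy₁, h0⟩
    have h2 : c • w ∈ Z.1 := by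
      have := Z.1.sub_mem hzZ h1.2
      rwa [sub_sub_cancel] at this
    have h3 : w ∈ X.1 ⊓ Z.1 := ⟨hwX, (Submodule.smul_mem_iff _ hc0).1 h2⟩
    rw [hXZ] at h3
    exact hwY h3.2
  refine ⟨w, hwX, hwY, c / B (z - c • w) w, div_ne_zero hc0 hb, Subtype.ext ?_⟩
  have hZsup : H ⊔ Submodule.span F {z} = Z.1 := by
    apply Submodule.eq_of_le_of_finrank_le
    · exact sup_le inf_le_right ((Submodule.span_singleton_le_iff_mem _ _).2 hzZ)
    · rw [Submodule.finrank_sup_span_singleton hzH]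
      exact hdZ.ge
  apply Submodule.eq_of_le_of_finrank_le
  · rw [← hZsup]
    refine sup_le ?_ ((Submodule.span_singleton_le_iff_mem _ _).2 ?_)
    · intro v hv
      exact (Generator.mem_transvect hB).2 ⟨v, hv.1, by rw [hwH v hv, mul_zero, zero_smul, add_zero]⟩
    · refine (Generator.mem_transvect hB).2 ⟨_, hy₁, ?_⟩
      rw [div_mul_cancel₀ _ hb, sub_add_cancel]
  · rw [Z.finrank_eq hn hBnd, Generator.finrank_eq hn hBnd]

omit [FiniteDimensional F V] in
theorem transvect_smul (c : F) : Y.transvect hB (c • w) a = Y.transvect hB w (a * c ^ 2) := by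
  have h : sympTransvection hB (c • w) a = sympTransvection hB w (a * c ^ 2) := by
    ext v
    simp only [sympTransvection_apply, map_smul, smul_eq_mul, smul_smul]
    congr 2
    ring
  unfold Generator.transvect
  simp only [h]

omit [FiniteDimensional F V] in
-- Vectors of Y do not distinguish w from w', and w' - w ∈ Y is itself fixed, being orthogonal to w
-- inside X. Equality follows by exchanging w and w'.
theorem transvect_eq_of_sub_mem {w' : V} (hw : w ∈ X.1) (hw' : w' ∈ X.1)
    (h : w' - w ∈ Y.1) : (Y.transvect hB w' a).1 ≤ (Y.transvect hB w a).1 := by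
  intro z hz
  obtain ⟨y, hy, rfl⟩ := (Generator.mem_transvect hB).1 hz
  have h1 : B y w' = B y w := by
    have := Y.apply_eq_zero hy h
    rwa [map_sub, sub_eq_zero] at this
  have h2 : B (w' - w) w = 0 := X.apply_eq_zero (X.1.sub_mem hw' hw) hw
  refine (Generator.mem_transvect hB).2
    ⟨y + (a * B y w) • (w' - w), Y.1.add_mem hy (Y.1.smul_mem _ h), ?_⟩
  rw [map_add, LinearMap.add_apply, map_smul, LinearMap.smul_apply, h2, h1, smul_zero, add_zero,
    smul_sub]
  abel

omit [FiniteDimensional F V] in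
theorem transvect_eq_iff {w' : V} (ha : a ≠ 0) (hw : w ∈ X.1) (hwY : w ∉ Y.1) (hw' : w' ∈ X.1)
    (hwY' : w' ∉ Y.1) :
    Y.transvect hB w' a = Y.transvect hB w a ↔ w' - w ∈ Y.1 ∨ w' + w ∈ Y.1 := by
  constructor
  · intro h
    have key : ∀ y ∈ Y.1, (B y w) • w - (B y w') • w' ∈ Y.1 := by
      intro y hy
      have h1 : y + (a * B y w') • w' ∈ (Y.transvect hB w a).1 :=
        h ▸ (Generator.mem_transvect hB).2 ⟨y, hy, rfl⟩
      obtain ⟨y', hy', he⟩ := (Generator.mem_transvect hB).1 h1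
      have h2 : y - y' = (a * B y' w) • w - (a * B y w') • w' := by
        rw [sub_eq_sub_iff_add_eq_add, ← he, add_comm]
      -- The difference y - y' lies in X, so it is orthogonal to w; this replaces y' by y in the
      -- coefficient of w.
      have h3 : y - y' ∈ X.1 := h2 ▸ X.1.sub_mem (X.1.smul_mem _ hw) (X.1.smul_mem _ hw')
      have h4 : B y w = B y' w := by
        have := X.apply_eq_zero h3 hw
        rwa [map_sub, LinearMap.sub_apply, sub_eq_zero] at this
      have h5 : a • ((B y w) • w - (B y w') • w') ∈ Y.1 := by
        rw [smul_sub, smul_smul, smul_smul, h4, ← h2]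
        exact Y.1.sub_mem hy hy'
      exact (Submodule.smul_mem_iff _ ha).1 h5
    obtain ⟨y, hy, hyw'⟩ : ∃ y ∈ Y.1, B y w' ≠ 0 := by
      by_contra! hcon
      exact hwY' (Y.mem_iff.2 hcon)
    obtain ⟨v, hv, hvw⟩ : ∃ y ∈ Y.1, B y w ≠ 0 := by
      by_contra! hcon
      exact hwY (Y.mem_iff.2 hcon)
    set c := B y w / B y w' with hc
    have h1 : w' - c • w ∈ Y.1 := by
      have h2 := Y.1.smul_mem (-(B y w')⁻¹) (key y hy)
      rwa [smul_sub, smul_smul, smul_smul, neg_mul, neg_mul, inv_mul_cancel₀ hyw', neg_smul,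
        neg_smul, one_smul, sub_neg_eq_add, neg_add_eq_sub, mul_comm, ← div_eq_mul_inv] at h2
    have h2 : B v w' = c * B v w := by
      have := Y.apply_eq_zero hv h1
      rwa [map_sub, map_smul, smul_eq_mul, sub_eq_zero] at this
    -- Modulo Y, w' is c w; substituting this in `key` at v leaves a multiple of w, which forces c²
    -- = 1.
    have h3 : (B v w * (1 - c ^ 2)) • w ∈ Y.1 := by
      have h4 := Y.1.add_mem (key v hv) (Y.1.smul_mem (B v w') h1)
      rw [h2] at h4
      convert h4 using 1
      module
    have h4 : c ^ 2 = 1 := by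
      by_contra hne
      exact hwY ((Submodule.smul_mem_iff _
        (mul_ne_zero hvw (sub_ne_zero.2 (Ne.symm hne)))).1 h3)
    rcases sq_eq_one_iff.1 h4 with h5 | h5
    · left; rwa [h5, one_smul] at h1
    · right; rwa [h5, neg_smul, one_smul, sub_neg_eq_add] at h1
  · rintro (h | h)
    · refine Subtype.ext (le_antisymm (transvect_eq_of_sub_mem hB hw hw' h)
        (transvect_eq_of_sub_mem hB hw' hw ?_))
      rw [← neg_sub]
      exact Y.1.neg_mem h
    · have h1 : Y.transvect hB w a = Y.transvect hB (-w) a := by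
        have := transvect_smul hB (Y := Y) (w := w) (a := a) (-1)
        rw [neg_one_sq, mul_one, neg_smul, one_smul] at this
        exact this.symm
      rw [h1]
      refine Subtype.ext (le_antisymm
        (transvect_eq_of_sub_mem hB (X.1.neg_mem hw) hw' (by rwa [sub_neg_eq_add]))
        (transvect_eq_of_sub_mem hB hw' (X.1.neg_mem hw) ?_))
      rw [← neg_add', add_comm]
      exact Y.1.neg_mem h

end Transvection

end GeneratorGeometry
-- The Maslov index: independence of bases, and its value on transvections.
section MaslovIndex

open Module

variable {F : Type*} [Field F] {V : Type*} [AddCommGroup V] [Module F V]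

theorem Module.Basis.repr_eq_zero_of_mem_span {ι : Type*} {X : Submodule F V} (e : Basis ι F X)
    {p : ι → Prop} {u : X} (hu : (u : V) ∈ Submodule.span F {v : V | ∃ i, p i ∧ (e i : V) = v})
    {i : ι} (hi : ¬ p i) : e.repr u i = 0 := by
  have h1 : {v : V | ∃ i, p i ∧ (e i : V) = v} = X.subtype '' (e '' {i | p i}) := by
    ext v
    simp [Set.mem_image]
  rw [h1, ← Submodule.map_span] at hu
  obtain ⟨u', hu', he⟩ := hu
  obtain rfl : u' = u := Subtype.ext he
  by_contra hne
  exact hi (e.mem_span_image.1 hu' (Finsupp.mem_support_iff.2 hne))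

theorem Fintype.sum_eq_sum_subtype {ι M : Type*} [Fintype ι] [AddCommMonoid M] (p : ι → Prop)
    [DecidablePred p] {f : ι → M} (hf : ∀ i, ¬ p i → f i = 0) :
    ∑ i, f i = ∑ i : {i // p i}, f i := by
  have h : ∑ i : {i // ¬ p i}, f i = 0 := Finset.sum_eq_zero fun i _ => hf i.1 i.2
  rw [← Fintype.sum_subtype_add_sum_subtype p f, h, add_zero]

/-- A basis of a subspace extends to a basis of any larger one, in the last positions. -/
theorem exists_basis_extending [FiniteDimensional F V] {X W : Submodule F V} (hW : W ≤ X)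
    {n m k : ℕ} (hkm : k + m = n) (hX : finrank F X = n) (e : Basis (Fin m) F W) :
    ∃ b : Basis (Fin n) F X, ∀ j : Fin m, (b (Fin.cast hkm (Fin.natAdd k j)) : V) = e j := by
  subst hkm
  obtain ⟨C, hC⟩ := Submodule.exists_isCompl (W.submoduleOf X)
  let e' : Basis (Fin m) F (W.submoduleOf X) := e.map (Submodule.submoduleOfEquivOfLe hW).symm
  have hdC : finrank F C = k := by
    have h1 := Submodule.finrank_add_eq_of_isCompl hC
    have h2 := Module.finrank_eq_card_basis e'
    rw [Fintype.card_fin] at h2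
    omega
  let c : Basis (Fin k) F C := finBasisOfFinrankEq F C hdC
  let b := ((c.prod e').map (Submodule.prodEquivOfIsCompl C _ hC.symm)).reindex finSumFinEquiv
  refine ⟨b, fun j => ?_⟩
  simp [b, e', Submodule.submoduleOfEquivOfLe]

theorem exists_adaptedBases [FiniteDimensional F V] {n : ℕ} {X Y : Submodule F V}
    (hX : finrank F X = n) (hY : finrank F Y = n) : Nonempty (AdaptedBases n X Y) := by
  have hkm : interCodim X Y + finrank F ↥(X ⊓ Y) = n := by
    rw [interCodim_add_finrank_inf, hX]
  let e := finBasis F ↥(X ⊓ Y)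
  obtain ⟨x, hx⟩ := exists_basis_extending inf_le_left hkm hX e
  obtain ⟨y, hy⟩ := exists_basis_extending inf_le_right hkm hY e
  have hcast : ∀ i : Fin n, interCodim X Y ≤ (i : ℕ) →
      ∃ j, i = Fin.cast hkm (Fin.natAdd _ j) := fun i hi =>
    ⟨⟨i - interCodim X Y, by omega⟩, Fin.ext (by simp [hi])⟩
  refine ⟨⟨x, y, fun i hi => ?_, ?_⟩⟩
  · obtain ⟨j, rfl⟩ := hcast i hi
    rw [hx, hy]
  · have h1 : {v : V | ∃ i : Fin n, interCodim X Y ≤ (i : ℕ) ∧ (x i : V) = v} =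
        (X ⊓ Y).subtype '' Set.range e := by
      ext v
      constructor
      · rintro ⟨i, hi, rfl⟩
        obtain ⟨j, rfl⟩ := hcast i hi
        exact ⟨_, ⟨j, rfl⟩, (hx j).symm⟩
      · rintro ⟨_, ⟨j, rfl⟩, rfl⟩
        exact ⟨_, by simp, hx j⟩
    rw [h1, ← Submodule.map_span, e.span_eq, Submodule.map_top, Submodule.range_subtype]

theorem AlternatingMap.apply_basis_eq {ι M : Type*} [Fintype ι] [DecidableEq ι] [AddCommGroup M]
    [Module F M] (f : M [⋀^ι]→ₗ[F] F) (e : Basis ι F M) (v : ι → M) :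
    f v = f e * e.det v := by
  conv_lhs => rw [f.eq_smul_basis_det e]
  rfl

namespace AdaptedBases

variable {n : ℕ} {X Y : Submodule F V}

theorem x_mem_right (b : AdaptedBases n X Y) {i : Fin n} (hi : interCodim X Y ≤ (i : ℕ)) :
    (b.x i : V) ∈ Y := by
  rw [b.common i hi]
  exact (b.y i).2

theorem y_mem_left (b : AdaptedBases n X Y) {i : Fin n} (hi : interCodim X Y ≤ (i : ℕ)) :
    (b.y i : V) ∈ X := by
  rw [← b.common i hi]
  exact (b.x i).2

theorem span_common' (b : AdaptedBases n X Y) :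
    Submodule.span F {v : V | ∃ i : Fin n, interCodim X Y ≤ (i : ℕ) ∧ (b.y i : V) = v}
      = X ⊓ Y := by
  rw [← b.span_common]
  congr 1
  ext v
  refine exists_congr fun i => and_congr_right fun hi => ?_
  rw [b.common i hi]

/-- The trailing vectors of every adapted basis span X ∩ Y, so the change of basis is block
triangular. -/
theorem toMatrix_x_eq_zero (b b' : AdaptedBases n X Y) {i j : Fin n}
    (hi : (i : ℕ) < interCodim X Y) (hj : interCodim X Y ≤ (j : ℕ)) :
    b.x.toMatrix b'.x i j = 0 := by
  refine b.x.repr_eq_zero_of_mem_span (p := fun i : Fin n => interCodim X Y ≤ (i : ℕ)) ?_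
    (not_le.2 hi)
  rw [b.span_common]
  exact ⟨(b'.x j).2, b'.x_mem_right hj⟩

theorem toMatrix_y_eq (b b' : AdaptedBases n X Y) (i : Fin n) {j : Fin n}
    (hj : interCodim X Y ≤ (j : ℕ)) : b.y.toMatrix b'.y i j = b.x.toMatrix b'.x i j := by
  have h : b'.y j = ∑ i, b.x.toMatrix b'.x i j • b.y i := by
    apply Subtype.ext
    rw [← b'.common j hj, ← b.x.sum_toMatrix_smul_self b'.x j]
    simp only [Submodule.coe_sum, Submodule.coe_smul]
    refine Finset.sum_congr rfl fun i _ => ?_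
    rcases lt_or_ge (i : ℕ) (interCodim X Y) with hi | hi
    · rw [b.toMatrix_x_eq_zero b' hi hj, zero_smul, zero_smul]
    · rw [b.common i hi]
  rw [Basis.toMatrix_apply, h, b.y.repr_sum_self]

end AdaptedBases

variable {B : LinearMap.BilinForm F V} {n : ℕ} {X Y : Generator B}

/-- The pairing matrix of a pair of adapted bases. -/
noncomputable def AdaptedBases.pairing {X Y : Submodule F V} (B : LinearMap.BilinForm F V)
    (b : AdaptedBases n X Y) :
    Matrix {i : Fin n // (i : ℕ) < interCodim X Y} {i : Fin n // (i : ℕ) < interCodim X Y} F :=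
  Matrix.of fun i j => B (b.x i.1 : V) (b.y j.1 : V)

/-- Trailing vectors lie in X ∩ Y and are orthogonal to X and to Y, so only the leading blocks
contribute. -/
theorem AdaptedBases.pairing_eq_mul (b b' : AdaptedBases n X.1 Y.1) :
    b'.pairing B =
      ((b.x.toMatrix b'.x).toSquareBlockProp fun i => (i : ℕ) < interCodim X.1 Y.1).transpose *
        b.pairing B *
        (b.y.toMatrix b'.y).toSquareBlockProp fun i => (i : ℕ) < interCodim X.1 Y.1 := by
  ext r s
  have hx : (b'.x r.1 : V) = ∑ i, b.x.toMatrix b'.x i r.1 • (b.x i : V) := by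
    rw [← b.x.sum_toMatrix_smul_self b'.x r.1]
    simp only [Submodule.coe_sum, Submodule.coe_smul]
  have hy : (b'.y s.1 : V) = ∑ j, b.y.toMatrix b'.y j s.1 • (b.y j : V) := by
    rw [← b.y.sum_toMatrix_smul_self b'.y s.1]
    simp only [Submodule.coe_sum, Submodule.coe_smul]
  have h1 : B (b'.x r.1 : V) (b'.y s.1 : V) = ∑ j, ∑ i,
      b.x.toMatrix b'.x i r.1 * B (b.x i : V) (b.y j : V) * b.y.toMatrix b'.y j s.1 := by
    rw [hx, hy]
    simp only [map_sum, LinearMap.sum_apply, map_smul, LinearMap.smul_apply, smul_eq_mul,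
      Finset.mul_sum]
    refine Finset.sum_congr rfl fun j _ => Finset.sum_congr rfl fun i _ => by ring
  simp only [AdaptedBases.pairing, Matrix.of_apply, Matrix.mul_apply, Matrix.transpose_apply,
    Finset.sum_mul]
  rw [h1, Fintype.sum_eq_sum_subtype (fun j : Fin n => (j : ℕ) < interCodim X.1 Y.1)]
  · refine Finset.sum_congr rfl fun j _ => ?_
    rw [Fintype.sum_eq_sum_subtype (fun i : Fin n => (i : ℕ) < interCodim X.1 Y.1)]
    · rfl
    · intro i hi
      rw [Y.apply_eq_zero (b.x_mem_right (not_lt.1 hi)) (b.y j.1).2, mul_zero, zero_mul]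
  · intro j hj
    refine Finset.sum_eq_zero fun i _ => ?_
    rw [X.apply_eq_zero (b.x i).2 (b.y_mem_left (not_lt.1 hj)), mul_zero, zero_mul]

/-- A kernel vector, extended by zero, yields an element of Y orthogonal to X. It lies in X ∩ Y, so
its leading coordinates vanish. -/
theorem AdaptedBases.det_pairing_ne_zero (b : AdaptedBases n X.1 Y.1) :
    (b.pairing B).det ≠ 0 := by
  intro h0
  obtain ⟨v, hv0, hv⟩ := Matrix.exists_mulVec_eq_zero_iff.2 h0
  refine hv0 (funext fun j => ?_)
  let c : Fin n → F := fun i => if h : (i : ℕ) < interCodim X.1 Y.1 then v ⟨i, h⟩ else 0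
  have hc : ∀ j : {i : Fin n // (i : ℕ) < interCodim X.1 Y.1}, c j.1 = v j := fun j =>
    dif_pos j.2
  have huX : ((∑ i, c i • b.y i : Y.1) : V) ∈ X.1 := by
    refine X.mem_iff.2 fun x hx => ?_
    obtain ⟨x, rfl⟩ : ∃ x' : X.1, (x' : V) = x := ⟨⟨x, hx⟩, rfl⟩
    rw [← b.x.sum_repr x]
    simp only [Submodule.coe_sum, Submodule.coe_smul, map_sum, LinearMap.sum_apply, map_smul,
      LinearMap.smul_apply, smul_eq_mul, Finset.mul_sum]
    rw [Finset.sum_comm]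
    refine Finset.sum_eq_zero fun i _ => ?_
    simp only [mul_left_comm _ (b.x.repr x i)]
    rw [← Finset.mul_sum]
    apply mul_eq_zero_of_right
    rcases lt_or_ge (i : ℕ) (interCodim X.1 Y.1) with hi | hi
    · rw [Fintype.sum_eq_sum_subtype (fun j : Fin n => (j : ℕ) < interCodim X.1 Y.1)]
      · have := congr_fun hv ⟨i, hi⟩
        simpa [Matrix.mulVec, dotProduct, AdaptedBases.pairing, hc, mul_comm] using this
      · intro j hj
        simp only [c, dif_neg hj, zero_mul]
    · refine Finset.sum_eq_zero fun j _ => ?_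
      rw [Y.apply_eq_zero (b.x_mem_right hi) (b.y j).2, mul_zero]
  have h := b.y.repr_eq_zero_of_mem_span (p := fun i : Fin n => interCodim X.1 Y.1 ≤ (i : ℕ))
    (u := ∑ i, c i • b.y i) (by rw [b.span_common']; exact ⟨huX, Submodule.coe_mem _⟩)
    (i := j.1) (not_le.2 j.2)
  rw [b.y.repr_sum_self, hc] at h
  exact h

theorem maslovScalar_eq {X Y : Submodule F V} (δX : X [⋀^Fin n]→ₗ[F] F)
    (δY : Y [⋀^Fin n]→ₗ[F] F) (b : AdaptedBases n X Y) :
    maslovScalar B δX δY b = δX b.x * δY b.y * (b.pairing B).det := rfl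

theorem maslovScalar_eq_of_interCodim_eq {X Y : Submodule F V} (δX : X [⋀^Fin n]→ₗ[F] F)
    (δY : Y [⋀^Fin n]→ₗ[F] F) (b : AdaptedBases n X Y) {m : ℕ} (hm : interCodim X Y = m) :
    maslovScalar B δX δY b = δX b.x * δY b.y *
      (Matrix.of fun i j : {i : Fin n // (i : ℕ) < m} => B (b.x i.1 : V) (b.y j.1 : V)).det := by
  subst hm
  rfl

theorem maslovScalar_ne_zero {δX : X.1 [⋀^Fin n]→ₗ[F] F} {δY : Y.1 [⋀^Fin n]→ₗ[F] F}
    (hX : δX ≠ 0) (hY : δY ≠ 0) (b : AdaptedBases n X.1 Y.1) :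
    maslovScalar B δX δY b ≠ 0 := by
  rw [maslovScalar_eq]
  exact mul_ne_zero (mul_ne_zero ((AlternatingMap.map_basis_ne_zero_iff b.x δX).2 hX)
    ((AlternatingMap.map_basis_ne_zero_iff b.y δY).2 hY)) b.det_pairing_ne_zero

/-- The scalars of two pairs of adapted bases differ by a square. -/
theorem exists_maslovScalar_eq_mul_sq (δX : X.1 [⋀^Fin n]→ₗ[F] F) (δY : Y.1 [⋀^Fin n]→ₗ[F] F)
    (b b' : AdaptedBases n X.1 Y.1) :
    ∃ c : F, maslovScalar B δX δY b' = maslovScalar B δX δY b * c ^ 2 := by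
  have hP := (b.x.toMatrix b'.x).twoBlockTriangular_det'
    (fun i : Fin n => (i : ℕ) < interCodim X.1 Y.1)
    fun i hi j hj => b.toMatrix_x_eq_zero b' hi (not_lt.1 hj)
  have hQ := (b.y.toMatrix b'.y).twoBlockTriangular_det'
    (fun i : Fin n => (i : ℕ) < interCodim X.1 Y.1)
    fun i hi j hj => (b.toMatrix_y_eq b' i (not_lt.1 hj)).trans
      (b.toMatrix_x_eq_zero b' hi (not_lt.1 hj))
  have hPQ : (b.y.toMatrix b'.y).toSquareBlockProp
        (fun i : Fin n => ¬ (i : ℕ) < interCodim X.1 Y.1) =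
      (b.x.toMatrix b'.x).toSquareBlockProp
        (fun i : Fin n => ¬ (i : ℕ) < interCodim X.1 Y.1) := by
    ext i j
    exact b.toMatrix_y_eq b' i.1 (not_lt.1 j.2)
  rw [hPQ] at hQ
  -- With leading blocks P₁, Q₁ and common trailing block R, the two forms contribute det P₁ det R
  -- and det Q₁ det R, and the pairing contributes det P₁ det Q₁.
  refine ⟨((b.x.toMatrix b'.x).toSquareBlockProp fun i => (i : ℕ) < interCodim X.1 Y.1).det *
    ((b.y.toMatrix b'.y).toSquareBlockProp fun i => (i : ℕ) < interCodim X.1 Y.1).det *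
    ((b.x.toMatrix b'.x).toSquareBlockProp fun i => ¬ (i : ℕ) < interCodim X.1 Y.1).det, ?_⟩
  rw [maslovScalar_eq, maslovScalar_eq, δX.apply_basis_eq b.x b'.x, δY.apply_basis_eq b.y b'.y,
    Basis.det_apply, Basis.det_apply, hP, hQ, b.pairing_eq_mul b', Matrix.det_mul, Matrix.det_mul,
    Matrix.det_transpose]
  ring

variable [Fintype F]

open Classical in
/-- The Maslov index does not depend on the choice of adapted bases. -/
theorem maslovIndex_eq (δ : ∀ X : Generator B, X.1 [⋀^Fin n]→ₗ[F] F) (hδ : ∀ X, δ X ≠ 0)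
    (b : AdaptedBases n X.1 Y.1) :
    maslovIndex B δ X Y = quadraticChar F (maslovScalar B (δ X) (δ Y) b) := by
  have h : Nonempty (AdaptedBases n X.1 Y.1) := ⟨b⟩
  rw [maslovIndex, dif_pos h]
  obtain ⟨c, hc⟩ := exists_maslovScalar_eq_mul_sq (δ X) (δ Y) b h.some
  have hc0 : c ≠ 0 := by
    rintro rfl
    exact maslovScalar_ne_zero (hδ X) (hδ Y) h.some (by rw [hc]; ring)
  rw [hc, map_mul, quadraticChar_sq_one' hc0, mul_one]

open Classical in
-- The transvection preserves B and fixes X, so with transported bases the pairing of (Z, X) is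
-- minus the transpose of that of (X, Y), while the 1 × 1 pairing of (Y, Z) is a times a square. All
-- remaining factors pair off into squares, and the sign is harmless as -1 is a square.
theorem maslovIndex_mul_transvect [FiniteDimensional F V] (hn : finrank F V = 2 * n)
    (hBnd : B.Nondegenerate) (hB : B.IsAlt) (hneg : IsSquare (-1 : F))
    (δ : ∀ X : Generator B, X.1 [⋀^Fin n]→ₗ[F] F) (hδ : ∀ X, δ X ≠ 0) {w : V} (hwX : w ∈ X.1)
    (hwY : w ∉ Y.1) {a : F} (ha : a ≠ 0) :
    maslovIndex B δ X Y * maslovIndex B δ Y (Y.transvect hB w a) *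
      maslovIndex B δ (Y.transvect hB w a) X = quadraticChar F a := by
  set Z := Y.transvect hB w a with hZ
  obtain ⟨b⟩ := exists_adaptedBases (X.finrank_eq hn hBnd) (Y.finrank_eq hn hBnd)
  obtain ⟨b₀⟩ := exists_adaptedBases (Y.finrank_eq hn hBnd) (Z.finrank_eq hn hBnd)
  let T : Y.1 ≃ₗ[F] Z.1 := (sympTransvection hB w a).submoduleMap Y.1
  have hT : ∀ y : Y.1, (T y : V) = sympTransvection hB w a y := fun y => rfl
  have hYZ : interCodim Y.1 Z.1 = 1 :=
    (dualPolarGraph_adj_iff hn hBnd).1 (adj_transvect hB hn hBnd hwY ha)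
  have hZX : interCodim Z.1 X.1 = interCodim X.1 Y.1 := by
    rw [interCodim_comm hn hBnd Z X, interCodim_transvect hB hwX]
  let b₁ : AdaptedBases n Z.1 X.1 :=
    { x := b.y.map T
      y := b.x
      common := fun i hi => by
        rw [hZX] at hi
        rw [Basis.map_apply, hT, sympTransvection_apply_of_eq_zero hB a
          (X.apply_eq_zero (b.y_mem_left hi) hwX), b.common i hi]
      span_common := by
        rw [inf_comm, inf_transvect_eq_of_mem hB hwX, ← b.span_common']
        congr 1
        ext v
        rw [hZX]
        refine exists_congr fun i => and_congr_right fun hi => ?_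
        rw [Basis.map_apply, hT, sympTransvection_apply_of_eq_zero hB a
          (X.apply_eq_zero (b.y_mem_left hi) hwX)] }
  have hfix : ∀ i : Fin n, interCodim Y.1 Z.1 ≤ (i : ℕ) → B (b₀.x i : V) w = 0 := fun i hi => by
    have : (b₀.x i : V) ∈ Y.1 ⊓ Z.1 := ⟨(b₀.x i).2, b₀.x_mem_right hi⟩
    rw [inf_transvect hB hwY ha] at this
    exact this.2
  let b₂ : AdaptedBases n Y.1 Z.1 :=
    { x := b₀.x
      y := b₀.x.map T
      common := fun i hi => by
        rw [Basis.map_apply, hT, sympTransvection_apply_of_eq_zero hB a (hfix i hi)]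
      span_common := b₀.span_common }
  have h1 := maslovScalar_ne_zero (hδ X) (hδ Y) b
  have h2 := maslovScalar_ne_zero (hδ Y) (hδ Z) b₂
  have h3 := maslovScalar_ne_zero (hδ Z) (hδ X) b₁
  -- Pulling δ_Z back to Y lets both forms be compared on the two bases `b.y` and `b₀.x` of Y; the
  -- same determinant then occurs twice.
  let δ' : Y.1 [⋀^Fin n]→ₗ[F] F := (δ Z).compLinearMap T.toLinearMap
  rw [maslovIndex_eq δ hδ b, maslovIndex_eq δ hδ b₂, maslovIndex_eq δ hδ b₁, ← map_mul, ← map_mul]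
  have hn0 : 0 < n := by
    have := interCodim_add_finrank_inf Y.1 Z.1
    have := Y.finrank_eq hn hBnd
    omega
  let i₀ : {i : Fin n // (i : ℕ) < 1} := ⟨⟨0, hn0⟩, Nat.zero_lt_one⟩
  let _ : Unique {i : Fin n // (i : ℕ) < 1} :=
    ⟨⟨i₀⟩, fun i => Subtype.ext (Fin.ext (Nat.lt_one_iff.1 i.2))⟩
  have e2 : maslovScalar B (δ Y) (δ Z) b₂ =
      δ Y b₀.x * δ' b₀.x * (a * B (b₀.x i₀.1 : V) w ^ 2) := by
    rw [maslovScalar_eq_of_interCodim_eq _ _ _ hYZ, Matrix.det_unique]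
    congr 1
    · change B (b₀.x i₀.1 : V) (b₀.x.map T i₀.1 : V) = _
      rw [Basis.map_apply, hT, sympTransvection_apply, map_add, hB.self_eq_zero, zero_add,
        map_smul, smul_eq_mul]
      ring
  obtain ⟨m, e3⟩ : ∃ m : ℕ, maslovScalar B (δ Z) (δ X) b₁ =
      δ' b.y * δ X b.x * ((-1) ^ m * (b.pairing B).det) := by
    refine ⟨Fintype.card {i : Fin n // (i : ℕ) < interCodim X.1 Y.1}, ?_⟩
    rw [maslovScalar_eq_of_interCodim_eq _ _ _ hZX, ← Matrix.det_transpose (b.pairing B),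
      ← Matrix.det_neg]
    congr 1
    · congr 1
      ext i j
      change B (b.y.map T i.1 : V) (b.x j.1 : V) = - B (b.x j.1 : V) (b.y i.1 : V)
      rw [hB.neg_eq, Basis.map_apply, hT]
      conv_lhs => rw [← sympTransvection_apply_of_eq_zero hB a
        (X.apply_eq_zero (b.x j.1).2 hwX)]
      exact apply_sympTransvection hB w a _ _
  have hsq : maslovScalar B (δ X) (δ Y) b * maslovScalar B (δ Y) (δ Z) b₂ *
      maslovScalar B (δ Z) (δ X) b₁ = a * (-1) ^ m *
      (δ X b.x * (b.pairing B).det * δ Y b₀.x * δ' b₀.x * b₀.x.det b.y *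
        B (b₀.x i₀.1 : V) w) ^ 2 := by
    rw [e2, e3, maslovScalar_eq, (δ Y).apply_basis_eq b₀.x b.y, δ'.apply_basis_eq b₀.x b.y]
    ring
  have hne := mul_ne_zero (mul_ne_zero h1 h2) h3
  rw [hsq] at hne ⊢
  rw [map_mul, map_mul, map_pow,
    (quadraticChar_one_iff_isSquare (neg_ne_zero.2 one_ne_zero)).2 hneg, one_pow,
    quadraticChar_sq_one' fun h0 => hne (by rw [h0]; ring), mul_one, mul_one]

end MaslovIndex
-- Counting the transvection images of Y.
section TransvectionCounting

open Module

variable {F : Type*} [Field F] [Fintype F] {V : Type*} [AddCommGroup V] [Module F V]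
  [FiniteDimensional F V] {B : LinearMap.BilinForm F V} {n : ℕ}

/-- The images of `Y` under the transvections with parameter `a` along vectors of `X` not in `Y`. -/
def transvectSet (hB : B.IsAlt) (X Y : Generator B) (a : F) : Set (Generator B) :=
  {Z | ∃ w ∈ X.1, w ∉ Y.1 ∧ Z = Y.transvect hB w a}

/-- With |X ∩ Y| = q^(n-k), there are q^n - q^(n-k) vectors w in X \ Y, and each fibre of w ↦
`Y.transvect hB w a` is the union of the two cosets ±w + (X ∩ Y). -/
theorem two_mul_ncard_transvectSet
    (hB : B.IsAlt) (h2 : (2 : F) ≠ 0) (X Y : Generator B) {a : F} (ha : a ≠ 0) :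
    2 * (transvectSet hB X Y a).ncard = Fintype.card F ^ interCodim X.1 Y.1 - 1 := by
  classical
  have : Finite V := Module.finite_of_finite F
  have := Fintype.ofFinite V
  have hcard : ∀ W : Submodule F V,
      (Finset.univ.filter (· ∈ W)).card = Fintype.card F ^ finrank F W := fun W => by
    rw [← Fintype.card_subtype]
    exact Module.card_eq_pow_finrank
  set I : Finset V := Finset.univ.filter (· ∈ X.1 ⊓ Y.1) with hI
  set IX : Finset V := Finset.univ.filter (· ∈ X.1) with hIX
  have hsub : I ⊆ IX := fun v hv => by
    simp only [hI, hIX, Finset.mem_filter, Finset.mem_univ, true_and] at hv ⊢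
    exact hv.1
  have hmemI : ∀ v, v ∈ I ↔ v ∈ X.1 ∧ v ∈ Y.1 := fun v => by
    simp only [hI, Finset.mem_filter, Finset.mem_univ, true_and, Submodule.mem_inf]
  have hmem : ∀ v, v ∈ IX \ I ↔ v ∈ X.1 ∧ v ∉ Y.1 := fun v => by
    simp only [Finset.mem_sdiff, hmemI, hIX, Finset.mem_filter, Finset.mem_univ, true_and]
    tauto
  let f : V → Generator B := fun w => Y.transvect hB w a
  have himage : transvectSet hB X Y a = ((IX \ I).image f : Set (Generator B)) := by
    ext Z
    simp only [transvectSet, Set.mem_ofPred_eq, Finset.coe_image, Set.mem_image, Finset.mem_coe,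
      hmem, f]
    exact ⟨fun ⟨w, h1, h2, h3⟩ => ⟨w, ⟨h1, h2⟩, h3.symm⟩,
      fun ⟨w, ⟨h1, h2⟩, h3⟩ => ⟨w, h1, h2, h3.symm⟩⟩
  have hfiber : ∀ Z ∈ (IX \ I).image f, ((IX \ I).filter fun w => f w = Z).card = 2 * I.card := by
    intro Z hZ
    obtain ⟨w, hw, rfl⟩ := Finset.mem_image.1 hZ
    rw [hmem] at hw
    have he : ((IX \ I).filter fun w' => f w' = f w) = I.image (w + ·) ∪ I.image (-w + ·) := by
      ext w'
      simp only [Finset.mem_filter, Finset.mem_union, Finset.mem_image, hmem, hmemI]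
      constructor
      · rintro ⟨⟨h1, h2⟩, h3⟩
        rcases (transvect_eq_iff hB ha hw.1 hw.2 h1 h2).1 h3 with h | h
        · exact Or.inl ⟨w' - w, ⟨X.1.sub_mem h1 hw.1, h⟩, by abel⟩
        · exact Or.inr ⟨w' + w, ⟨X.1.add_mem h1 hw.1, h⟩, by abel⟩
      · rintro (⟨u, ⟨hu, hu'⟩, rfl⟩ | ⟨u, ⟨hu, hu'⟩, rfl⟩)
        · have h1 := X.1.add_mem hw.1 hu
          have h2 : w + u ∉ Y.1 := fun h => hw.2 ((Submodule.add_mem_iff_left _ hu').1 h)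
          exact ⟨⟨h1, h2⟩, (transvect_eq_iff hB ha hw.1 hw.2 h1 h2).2
            (Or.inl (by rwa [add_sub_cancel_left]))⟩
        · have h1 := X.1.add_mem (X.1.neg_mem hw.1) hu
          have h2 : -w + u ∉ Y.1 := fun h =>
            hw.2 (Y.1.neg_mem_iff.1 ((Submodule.add_mem_iff_left _ hu').1 h))
          exact ⟨⟨h1, h2⟩, (transvect_eq_iff hB ha hw.1 hw.2 h1 h2).2
            (Or.inr (by rwa [neg_add_eq_sub, sub_add_cancel]))⟩
    -- A common vector would put 2w in Y, hence w, as 2 is invertible.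
    have hdisj : Disjoint (I.image (w + ·)) (I.image (-w + ·)) := by
      rw [Finset.disjoint_left]
      intro v hv hv'
      obtain ⟨u, hu, rfl⟩ := Finset.mem_image.1 hv
      obtain ⟨u', hu', he⟩ := Finset.mem_image.1 hv'
      rw [hmemI] at hu hu'
      have h3 : (2 : F) • w = u' - u := by
        rw [two_smul, eq_sub_iff_add_eq, ← add_left_cancel_iff (a := -w), he]
        abel
      exact hw.2 ((Submodule.smul_mem_iff _ h2).1 (h3 ▸ Y.1.sub_mem hu'.2 hu.2))
    rw [he, Finset.card_union_of_disjoint hdisj, Finset.card_image_of_injective _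
      (add_right_injective w), Finset.card_image_of_injective _ (add_right_injective (-w)), two_mul]
  have hcount := Finset.card_eq_sum_card_image f (IX \ I)
  rw [Finset.sum_const_nat hfiber, Finset.card_sdiff_of_subset hsub, hcard, hcard,
    ← interCodim_add_finrank_inf X.1 Y.1, pow_add] at hcount
  rw [himage, Set.ncard_coe_finset]
  have hpos : 0 < Fintype.card F ^ finrank F ↥(X.1 ⊓ Y.1) := pow_pos Fintype.card_pos _
  apply Nat.eq_of_mul_eq_mul_right hpos
  rw [Nat.sub_mul, one_mul, hcount]
  ring

omit [Fintype F] [FiniteDimensional F V] in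
theorem transvectSet_mul_sq (hB : B.IsAlt) (X Y : Generator B) (a : F) {c : F} (hc : c ≠ 0) :
    transvectSet hB X Y (a * c ^ 2) = transvectSet hB X Y a := by
  have hsub : ∀ (a : F) {c : F}, c ≠ 0 →
      transvectSet hB X Y (a * c ^ 2) ⊆ transvectSet hB X Y a := by
    rintro a c hc Z ⟨w, hwX, hwY, rfl⟩
    exact ⟨c • w, X.1.smul_mem c hwX, fun h => hwY ((Submodule.smul_mem_iff _ hc).1 h),
      (transvect_smul hB c).symm⟩
  refine (hsub a hc).antisymm ?_
  have := hsub (a * c ^ 2) (inv_ne_zero hc)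
  rwa [mul_assoc, ← mul_pow, mul_inv_cancel₀ hc, one_pow, mul_one] at this

omit [FiniteDimensional F V] in
-- A finite field has only two square classes of nonzero elements, and rescaling w shows that only
-- the class of a matters.
theorem transvectSet_eq_or_eq (hB : B.IsAlt) (X Y : Generator B) {ν : F} (hν : ¬ IsSquare ν)
    {a : F} (ha : a ≠ 0) :
    transvectSet hB X Y a = transvectSet hB X Y 1 ∨
      transvectSet hB X Y a = transvectSet hB X Y ν := by
  classical
  have hν0 : ν ≠ 0 := by
    rintro rfl
    exact hν IsSquare.zero
  by_cases h : IsSquare a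
  · obtain ⟨c, rfl⟩ := h
    left
    rw [← transvectSet_mul_sq hB X Y 1 (left_ne_zero_of_mul ha), one_mul, sq]
  · right
    have h1 : IsSquare (a * ν) := by
      rw [← quadraticChar_one_iff_isSquare (mul_ne_zero ha hν0), map_mul,
        quadraticChar_neg_one_iff_not_isSquare.2 h, quadraticChar_neg_one_iff_not_isSquare.2 hν]
      norm_num
    obtain ⟨c, hc⟩ := h1
    have hc0 : c ≠ 0 := by
      rintro rfl
      exact mul_ne_zero ha hν0 (by rw [hc, mul_zero])
    rw [← transvectSet_mul_sq hB X Y ν (div_ne_zero hc0 hν0)]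
    congr 1
    field_simp
    rw [sq, ← hc, mul_comm]

theorem isCoherent_transvect_iff (hn : finrank F V = 2 * n) (hBnd : B.Nondegenerate)
    (hB : B.IsAlt) (hneg : IsSquare (-1 : F)) (δ : ∀ X : Generator B, X.1 [⋀^Fin n]→ₗ[F] F)
    (hδ : ∀ X, δ X ≠ 0) {X Y : Generator B} {w : V} (hwX : w ∈ X.1) (hwY : w ∉ Y.1) {a : F}
    (ha : a ≠ 0) : IsCoherent B δ X Y (Y.transvect hB w a) ↔ IsSquare a := by
  classical
  have hXY : X ≠ Y := by
    rintro rfl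
    exact hwY hwX
  have hZX : Y.transvect hB w a ≠ X := by
    intro h
    have h1 := interCodim_transvect hB (Y := Y) (a := a) hwX
    rw [h, (interCodim_eq_zero_iff hn hBnd).2 rfl, eq_comm, interCodim_eq_zero_iff hn hBnd] at h1
    exact hXY h1
  rw [IsCoherent, maslovIndex_mul_transvect hn hBnd hB hneg δ hδ hwX hwY ha,
    quadraticChar_one_iff_isSquare ha]
  exact ⟨fun h => h.2.2.2, fun h => ⟨hXY, (adj_transvect hB hn hBnd hwY ha).ne, hZX, h⟩⟩

end TransvectionCounting

/-! ### The final count. -/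

theorem theorem4p7 {F : Type*} [Field F] [Fintype F] {V : Type*} [AddCommGroup V] [Module F V]
    [FiniteDimensional F V] (q n : ℕ) (hqF : Fintype.card F = q) (hq : q % 4 = 1)
    (hn1 : 1 ≤ n) (hn : Module.finrank F V = 2 * n)
    (B : LinearMap.BilinForm F V) (hBalt : B.IsAlt) (hBnd : B.Nondegenerate)
    (δ : ∀ X : Generator B, X.1 [⋀^Fin n]→ₗ[F] F) (hδ : ∀ X, δ X ≠ 0)
    (k : ℕ) (X Y : Generator B) (hXY : (dualPolarGraph B).dist X Y = k) :
    {Z : Generator B | (dualPolarGraph B).Adj Y Z ∧ (dualPolarGraph B).dist X Z = k}.ncard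
        = q ^ k - 1 ∧
      2 * {Z : Generator B | ((dualPolarGraph B).Adj Y Z ∧ (dualPolarGraph B).dist X Z = k) ∧
          IsCoherent B δ X Y Z}.ncard
        = q ^ k - 1 := by
  subst hqF
  have hneg : IsSquare (-1 : F) := FiniteField.isSquare_neg_one_iff.2 (by omega)
  have hchar : ringChar F ≠ 2 := fun h => by
    have := FiniteField.even_card_iff_char_two.1 h
    omega
  have h2 : (2 : F) ≠ 0 := Ring.two_ne_zero hchar
  obtain ⟨ν, hν⟩ := FiniteField.exists_nonsquare hchar
  have hν0 : ν ≠ 0 := by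
    rintro rfl
    exact hν IsSquare.zero
  simp only [dualPolarGraph_dist_eq hn hBnd hBalt] at hXY ⊢
  subst hXY
  have hcoh : ∀ {a : F}, a ≠ 0 → ∀ Z ∈ transvectSet hBalt X Y a,
      (IsCoherent B δ X Y Z ↔ IsSquare a) := by
    rintro a ha _ ⟨w, hwX, hwY, rfl⟩
    exact isCoherent_transvect_iff hn hBnd hBalt hneg δ hδ hwX hwY ha
  have hset : {Z : Generator B | (dualPolarGraph B).Adj Y Z ∧
      interCodim X.1 Z.1 = interCodim X.1 Y.1} =
      transvectSet hBalt X Y 1 ∪ transvectSet hBalt X Y ν := by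
    ext Z
    constructor
    · rintro ⟨hYZ, hXZ⟩
      obtain ⟨w, hwX, hwY, a, ha, hZ⟩ := exists_transvect_eq hBalt hn hBnd hYZ hXZ
      have hmem : Z ∈ transvectSet hBalt X Y a := ⟨w, hwX, hwY, hZ⟩
      rcases transvectSet_eq_or_eq hBalt X Y hν ha with h | h
      · exact Or.inl (h ▸ hmem)
      · exact Or.inr (h ▸ hmem)
    · rintro (⟨w, hwX, hwY, rfl⟩ | ⟨w, hwX, hwY, rfl⟩)
      · exact ⟨adj_transvect hBalt hn hBnd hwY one_ne_zero, interCodim_transvect hBalt hwX⟩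
      · exact ⟨adj_transvect hBalt hn hBnd hwY hν0, interCodim_transvect hBalt hwX⟩
  have hcohset : {Z : Generator B | ((dualPolarGraph B).Adj Y Z ∧
      interCodim X.1 Z.1 = interCodim X.1 Y.1) ∧ IsCoherent B δ X Y Z} =
      transvectSet hBalt X Y 1 := by
    ext Z
    have hZ := Set.ext_iff.1 hset Z
    constructor
    · rintro ⟨h, hc⟩
      rcases hZ.1 h with h1 | h1
      · exact h1
      · exact absurd ((hcoh hν0 Z h1).1 hc) hν
    · exact fun h => ⟨hZ.2 (Or.inl h), (hcoh one_ne_zero Z h).2 IsSquare.one⟩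
  have : Finite V := Module.finite_of_finite F
  -- Coherence separates the two classes: a common member would make ν a square.
  have hdisj : Disjoint (transvectSet hBalt X Y 1) (transvectSet hBalt X Y ν) :=
    Set.disjoint_left.2 fun Z h1 h3 =>
      hν ((hcoh hν0 Z h3).1 ((hcoh one_ne_zero Z h1).2 IsSquare.one))
  have hc1 := two_mul_ncard_transvectSet hBalt h2 X Y (one_ne_zero (α := F))
  have hcν := two_mul_ncard_transvectSet hBalt h2 X Y hν0
  rw [hset, hcohset, Set.ncard_union_eq hdisj (Set.toFinite _) (Set.toFinite _)]
  omega
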